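/- Let $n\ge 2$ be an integer and $\kappa>0$. Let $\mathbb H^n(-\kappa)$ be the hyperbolic $n$-space of constant curvature $-\kappa$, with metric $g_\kappa$, volume measure $dv_{g_\kappa}$, and origin $\mathbf 0$ (in the Poincaré ball model: the open unit ball of $\mathbb R^n$ with $g_\kappa = \frac{4\,|dx|^2}{\kappa(1-|x|^2)^2}$ and $\mathbf 0$ its centre). Let $r(x)=\mathrm{dist}_{g_\kappa}(x,\mathbf 0)$ and, for $R>0$, let $B_R(\mathbf 0)=\{x : r(x)<R\}$. Then for every real-valued $u\in C_c^\infty(\mathbb H^n(-\kappa))$ and every $R>0$, $$\int_{\mathbb H^n(-\kappa)\setminus B_R(\mathbf 0)}|\nabla u|^2\,dv_{g_\kappa}\ \ge\ \int_{\mathbb H^n(-\kappa)\setminus B_R(\mathbf 0)}\Big\{\frac{(n-1)^2\kappa}{4}+\frac1{4r^2}+\frac{(n-1)(n-3)\kappa}{4\sinh^2(\sqrt\kappa\, r)}\Big\}u^2\,dv_{g_\kappa},$$ where $\nabla$ and $|\cdot|$ are the gradient and the norm of $g_\kappa$. Moreover, $$\int_{\mathbb H^n(-\kappa)}|\nabla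 u|^2\,dv_{g_\kappa}\ \ge\ \int_{\mathbb H^n(-\kappa)}\Big\{\frac{(n-1)^2\kappa}{4}+\frac1{4r^2}+\frac{(n-1)(n-3)\kappa}{4\sinh^2(\sqrt\kappa\, r)}\Big\}u^2\,dv_{g_\kappa}.$$ In both inequalities the integrands on the two sides are integrable over the region of integration. -/

import Mathlib

open MeasureTheory Set

noncomputable section

namespace Hyp

/-- The coordinate space `ℝⁿ` with its Euclidean norm. -/
abbrev E (n : ℕ) : Type := EuclideanSpace ℝ (Fin n)

/-! ### Riemannian geometry of an open set `Ω ⊆ ℝⁿ`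

A Riemannian metric on `Ω` is given by its values `g x v w = g_x(v, w)` on tangent vectors
`v, w ∈ T_x Ω = ℝⁿ`. -/

/-- The coefficients `g_{ij}(x) = g_x(e_i, e_j)` of the metric in the standard coordinates. -/
def gram {n : ℕ} (g : E n → E n → E n → ℝ) (x : E n) : Matrix (Fin n) (Fin n) ℝ :=
  Matrix.of fun i j => g x (EuclideanSpace.single i 1) (EuclideanSpace.single j 1)

/-- The Riemannian length `∫₀¹ √(g(γ'(t), γ'(t))) dt` of a curve `γ : [0, 1] → ℝⁿ`. -/
def curveLength {n : ℕ} (g : E n → E n → E n → ℝ) (γ : ℝ → E n) : ℝ :=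
  ∫ t in (0 : ℝ)..1,
    √(g (γ t) (derivWithin γ (Icc 0 1) t) (derivWithin γ (Icc 0 1) t))

/-- The Riemannian distance on `Ω`: the infimum of the lengths of the `C¹` curves in `Ω`
from `x` to `y`. -/
def riemDist {n : ℕ} (g : E n → E n → E n → ℝ) (Ω : Set (E n)) (x y : E n) : ℝ :=
  sInf {L : ℝ | ∃ γ : ℝ → E n, ContDiffOn ℝ 1 γ (Icc 0 1) ∧ MapsTo γ (Icc 0 1) Ω ∧
    γ 0 = x ∧ γ 1 = y ∧ L = curveLength g γ}

/-- The Riemannian volume measure `dv_g = √(det g_{ij}) dx` on `Ω` (extended by zero to `ℝⁿ`). -/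
def riemVolume {n : ℕ} (g : E n → E n → E n → ℝ) (Ω : Set (E n)) : Measure (E n) :=
  (volume.restrict Ω).withDensity fun x => ENNReal.ofReal √((gram g x).det)

/-- The Riemannian gradient `(∇u)^i = g^{ij} ∂_j u`. -/
def riemGradient {n : ℕ} (g : E n → E n → E n → ℝ) (u : E n → ℝ) (x : E n) : E n :=
  WithLp.toLp 2 (Matrix.mulVec (gram g x)⁻¹
    (fun j => fderiv ℝ u x (EuclideanSpace.single j 1)))

/-! ### Hyperbolic space `ℍⁿ(-κ)` in the Poincaré ball model -/

/-- The underlying set of `ℍⁿ(-κ)`: the open unit ball of `ℝⁿ`. The origin is `0`. -/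
def space (n : ℕ) : Set (E n) := Metric.ball 0 1

/-- The metric `g_κ = 4 |dx|² / (κ (1 - |x|²)²)` of constant curvature `-κ` on the unit ball. -/
def metric (n : ℕ) (κ : ℝ) (x v w : E n) : ℝ :=
  4 / (κ * (1 - ‖x‖ ^ 2) ^ 2) * inner ℝ v w

/-- The distance `r(x) = dist_{g_κ}(x, 0)` to the origin. -/
def r (n : ℕ) (κ : ℝ) (x : E n) : ℝ := riemDist (metric n κ) (space n) x 0

/-- The open geodesic ball `B_R(0)`. -/
def geodBall (n : ℕ) (κ R : ℝ) : Set (E n) := {x ∈ space n | r n κ x < R}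

/-- The volume measure `dv_{g_κ}`. -/
def vol (n : ℕ) (κ : ℝ) : Measure (E n) := riemVolume (metric n κ) (space n)

/-- The squared norm `|∇u|² = g_κ(∇u, ∇u)` of the gradient of `u`. -/
def gradSq (n : ℕ) (κ : ℝ) (u : E n → ℝ) (x : E n) : ℝ :=
  metric n κ x (riemGradient (metric n κ) u x) (riemGradient (metric n κ) u x)

/-- The weight `(n-1)²κ/4 + 1/(4r²) + (n-1)(n-3)κ/(4 sinh²(√κ r))`; its value at the single
point `r = 0` is irrelevant. -/
def weight (n : ℕ) (κ : ℝ) (x : E n) : ℝ :=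
  ((n : ℝ) - 1) ^ 2 * κ / 4 + 1 / (4 * r n κ x ^ 2)
    + ((n : ℝ) - 1) * ((n : ℝ) - 3) * κ / (4 * Real.sinh (√κ * r n κ x) ^ 2)

/-- `u ∈ C_c^∞(ℍⁿ(-κ))`: smooth functions with compact support in the open unit ball,
extended by zero to `ℝⁿ`. -/
def IsTestFunction (n : ℕ) (u : E n → ℝ) : Prop :=
  ContDiff ℝ (⊤ : ℕ∞) u ∧ HasCompactSupport u ∧ tsupport u ⊆ space n

end Hyp

end

/-! The inequality is one-dimensional along each ray from the origin. The metric is conformal, g =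
h² |dx|² with h = `conf`, so r = (2/√κ) artanh |x|, the volume density is hⁿ, and |∇u|² is at least
the squared radial derivative divided by h².

Along a ray, let J be the area density of geodesic spheres, proportional to sinh(√κ r)^(n-1), and
let a = `drift` be minus the logarithmic r-derivative of the supersolution r^(1/2) sinh(√κ
r)^(-(n-1)/2). Expand (u' + a u)² ≥ 0 and integrate a J (u²)' by parts. The Riccati identity
`drift_riccati` turns the remaining terms into the weight. The boundary term at the outer end
vanishes because u has compact support; at the inner end it is a J u² with a favourable sign, since
a ≥ 0 (`drift_nonneg`). This is why no condition on u is needed on ∂B_R. Integrating over directions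
(`integral_nonneg_of_radial`) gives the exterior inequality, `setIntegral_annulus_le`.

For the whole space, let R → 0. The weight is nonnegative and the exterior integrals are bounded by
the full Dirichlet integral, so integrability and the inequality both pass to the limit. -/

noncomputable section

namespace Hyp

/-! ### Distance to the origin and geodesic balls -/

/-- The factor `h` with `g_κ = h(|x|)² |dx|²`. -/
def conf (κ t : ℝ) : ℝ := 2 / (√κ * (1 - t ^ 2))

/-- The hyperbolic distance to the origin as a function of the Euclidean one. -/
def rad (κ t : ℝ) : ℝ := 2 / √κ * Real.artanh t

lemma hasDerivAt_artanh {t : ℝ} (ht : t ∈ Ioo (-1 : ℝ) 1) :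
    HasDerivAt Real.artanh (1 / (1 - t ^ 2)) t := by
  have h1 : 0 < 1 - t := by linarith [ht.2]
  have h2 : 0 < 1 + t := by linarith [ht.1]
  have h : HasDerivAt (fun s : ℝ => 1 / 2 * (Real.log (1 + s) - Real.log (1 - s)))
      (1 / 2 * (1 / (1 + t) - (-1) / (1 - t))) t :=
    ((((hasDerivAt_id t).const_add 1).log h2.ne').sub
      (((hasDerivAt_id t).const_sub 1).log h1.ne')).const_mul _
  have he : (1 / 2 * (1 / (1 + t) - (-1) / (1 - t))) = 1 / (1 - t ^ 2) := by
    have : 1 - t ^ 2 ≠ 0 := by nlinarith [mul_pos h1 h2]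
    field_simp
    ring
  rw [← he]
  refine h.congr_of_eventuallyEq ?_
  filter_upwards [Ioo_mem_nhds ht.1 ht.2] with s hs
  rw [Real.artanh_eq_half_log ⟨hs.1.le, hs.2.le⟩,
    Real.log_div (by linarith [hs.1]) (by linarith [hs.2])]

lemma hasDerivAt_rad {κ t : ℝ} (ht : t ∈ Ioo (-1 : ℝ) 1) :
    HasDerivAt (rad κ) (conf κ t) t := by
  refine ((hasDerivAt_artanh ht).const_mul (2 / √κ)).congr_deriv ?_
  rw [conf, div_mul_div_comm, mul_one]

lemma one_sub_sq_pos {t : ℝ} (ht : t ∈ Ioo (-1 : ℝ) 1) : 0 < 1 - t ^ 2 := by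
  nlinarith [ht.1, ht.2]

lemma conf_pos {κ t : ℝ} (hκ : 0 < κ) (ht : t ∈ Ioo (-1 : ℝ) 1) : 0 < conf κ t :=
  div_pos two_pos (mul_pos (Real.sqrt_pos.2 hκ) (one_sub_sq_pos ht))

lemma norm_mem_Ioo {n : ℕ} {x : E n} (hx : x ∈ space n) : ‖x‖ ∈ Ioo (-1 : ℝ) 1 :=
  ⟨by linarith [norm_nonneg x], by simpa [space] using hx⟩

lemma conf_sq {κ t : ℝ} (hκ : 0 < κ) : conf κ t ^ 2 = 4 / (κ * (1 - t ^ 2) ^ 2) := by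
  rw [conf, div_pow, mul_pow, Real.sq_sqrt hκ.le]
  norm_num

lemma sqrt_metric {n : ℕ} {κ : ℝ} (hκ : 0 < κ) {x : E n} (hx : x ∈ space n) (v : E n) :
    √(metric n κ x v v) = conf κ ‖x‖ * ‖v‖ := by
  rw [metric, ← conf_sq hκ, real_inner_self_eq_norm_sq, ← mul_pow, Real.sqrt_sq]
  exact mul_nonneg (conf_pos hκ (norm_mem_Ioo hx)).le (norm_nonneg _)

lemma continuousOn_conf {κ : ℝ} (hκ : 0 < κ) : ContinuousOn (conf κ) (Ioo (-1) 1) := by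
  unfold conf
  refine continuousOn_const.div (by fun_prop) fun t ht => ?_
  exact (mul_pos (Real.sqrt_pos.2 hκ) (one_sub_sq_pos ht)).ne'

lemma curveLength_segment {n : ℕ} {κ : ℝ} (hκ : 0 < κ) {x : E n} (hx : x ∈ space n) :
    curveLength (metric n κ) (fun t => (1 - t) • x) = rad κ ‖x‖ := by
  have hm : ∀ t ∈ Icc (0 : ℝ) 1, (1 - t) * ‖x‖ ∈ Ioo (-1 : ℝ) 1 := fun t ht =>
    ⟨by nlinarith [norm_nonneg x, ht.2], by nlinarith [norm_nonneg x, ht.1, (norm_mem_Ioo hx).2]⟩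
  have hn : ∀ t ∈ Icc (0 : ℝ) 1, ‖(1 - t) • x‖ = (1 - t) * ‖x‖ := fun t ht => by
    rw [norm_smul, Real.norm_of_nonneg (by linarith [ht.2])]
  have hd : ∀ t ∈ Icc (0 : ℝ) 1,
      derivWithin (fun t : ℝ => (1 - t) • x) (Icc 0 1) t = -x := fun t ht => by
    have : HasDerivAt (fun t : ℝ => (1 - t) • x) ((-1 : ℝ) • x) t :=
      ((hasDerivAt_id t).const_sub 1).smul_const x
    rw [this.hasDerivWithinAt.derivWithin (uniqueDiffOn_Icc one_pos t ht), neg_one_smul]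
  have hI : curveLength (metric n κ) (fun t => (1 - t) • x)
      = ∫ t in (0 : ℝ)..1, conf κ ((1 - t) * ‖x‖) * ‖x‖ := by
    refine intervalIntegral.integral_congr fun t ht => ?_
    rw [uIcc_of_le zero_le_one] at ht
    have hs : (1 - t) • x ∈ space n := by
      rw [space, mem_ball_zero_iff, hn t ht]
      exact (hm t ht).2
    simp only [hd t ht]
    rw [sqrt_metric hκ hs, hn t ht, norm_neg]
  rw [hI, intervalIntegral.integral_eq_sub_of_hasDerivAt
    (f := fun t => -rad κ ((1 - t) * ‖x‖))]
  · simp [rad]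
  · intro t ht
    rw [uIcc_of_le zero_le_one] at ht
    have h := ((hasDerivAt_rad (κ := κ) (hm t ht)).comp t
      (((hasDerivAt_id t).const_sub 1).mul_const ‖x‖)).neg
    exact h.congr_deriv (by ring)
  · refine ContinuousOn.intervalIntegrable ?_
    rw [uIcc_of_le zero_le_one]
    exact ((continuousOn_conf hκ).comp (by fun_prop) hm).mul continuousOn_const

/-- Projecting a curve onto the line through x does not increase its speed, and it moves points
towards the origin, where h is smaller. What remains is a curve on a diameter, on which `rad` is a
primitive of h. -/
lemma rad_le_curveLength {n : ℕ} {κ : ℝ} (hκ : 0 < κ) {x : E n} {γ : ℝ → E n}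
    (hγ : ContDiffOn ℝ 1 γ (Icc 0 1)) (hm : MapsTo γ (Icc 0 1) (space n))
    (h0 : γ 0 = x) (h1 : γ 1 = 0) : rad κ ‖x‖ ≤ curveLength (metric n κ) γ := by
  -- For x = 0 this is e = 0, and the bounds below still hold; hence only ‖e‖ ≤ 1.
  set e : E n := ‖x‖⁻¹ • x with he
  have hen : ‖e‖ ≤ 1 := by
    rw [he, norm_smul, norm_inv, norm_norm]
    exact inv_mul_le_one
  have hex : inner ℝ e x = ‖x‖ := by
    rw [he, real_inner_smul_left, real_inner_self_eq_norm_sq, sq]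
    by_cases hx : ‖x‖ = 0
    · simp [hx]
    · field_simp
  have habs : ∀ v : E n, |inner ℝ e v| ≤ ‖v‖ := fun v =>
    (abs_real_inner_le_norm e v).trans (mul_le_of_le_one_left (norm_nonneg v) hen)
  have hin : ∀ t ∈ Icc (0 : ℝ) 1, inner ℝ e (γ t) ∈ Ioo (-1 : ℝ) 1 := fun t ht =>
    abs_lt.1 ((habs _).trans_lt (norm_mem_Ioo (hm ht)).2)
  have hc : ContinuousOn (fun t => conf κ ‖γ t‖ * ‖derivWithin γ (Icc 0 1) t‖) (Icc 0 1) :=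
    ((continuousOn_conf hκ).comp hγ.continuousOn.norm fun t ht => norm_mem_Ioo (hm ht)).mul
      (hγ.continuousOn_derivWithin (uniqueDiffOn_Icc one_pos) le_rfl).norm
  have hL : curveLength (metric n κ) γ
      = ∫ t in (0 : ℝ)..1, conf κ ‖γ t‖ * ‖derivWithin γ (Icc 0 1) t‖ := by
    refine intervalIntegral.integral_congr fun t ht => ?_
    rw [uIcc_of_le zero_le_one] at ht
    exact sqrt_metric hκ (hm ht) _
  have key := intervalIntegral.sub_le_integral_of_hasDeriv_right_of_le
    (g := fun t => -rad κ (inner ℝ e (γ t)))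
    (g' := fun t => -(conf κ (inner ℝ e (γ t)) * inner ℝ e (derivWithin γ (Icc 0 1) t)))
    (zero_le_one' ℝ) ?_ ?_ (hc.integrableOn_Icc) ?_
  · rw [hL]
    refine le_trans (le_of_eq ?_) key
    simp [h0, h1, hex, rad]
  · intro t ht
    have hi : ContinuousWithinAt (fun t => inner ℝ e (γ t)) (Icc 0 1) t :=
      continuousWithinAt_const.inner (hγ.continuousOn t ht)
    exact ((hasDerivAt_rad (hin t ht)).continuousAt.comp_continuousWithinAt
      (f := fun t => (inner ℝ e (γ t) : ℝ)) hi).neg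
  · intro t ht
    have hd : HasDerivAt γ (derivWithin γ (Icc 0 1) t) t :=
      ((hγ.differentiableOn one_ne_zero t (Ioo_subset_Icc_self ht)).hasDerivWithinAt).hasDerivAt
        (Icc_mem_nhds ht.1 ht.2)
    have hi : HasDerivAt (fun t => inner ℝ e (γ t)) (inner ℝ e (derivWithin γ (Icc 0 1) t)) t := by
      simpa using (hasDerivAt_const t e).inner ℝ hd
    exact ((hasDerivAt_rad (hin t (Ioo_subset_Icc_self ht))).comp t hi).neg.hasDerivWithinAt
  · intro t ht
    have ht' := Ioo_subset_Icc_self ht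
    have hp := conf_pos hκ (hin t ht')
    have hq := conf_pos hκ (norm_mem_Ioo (hm ht'))
    have hle : conf κ (inner ℝ e (γ t)) ≤ conf κ ‖γ t‖ := by
      have h3 := one_sub_sq_pos (norm_mem_Ioo (hm ht'))
      have h4 : inner ℝ e (γ t) ^ 2 ≤ ‖γ t‖ ^ 2 :=
        sq_le_sq.2 ((habs _).trans (le_abs_self _))
      have h5 := Real.sqrt_pos.2 hκ
      unfold conf
      gcongr
    calc -(conf κ (inner ℝ e (γ t)) * inner ℝ e (derivWithin γ (Icc 0 1) t))
        = conf κ (inner ℝ e (γ t)) * -inner ℝ e (derivWithin γ (Icc 0 1) t) := by ring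
      _ ≤ conf κ (inner ℝ e (γ t)) * ‖derivWithin γ (Icc 0 1) t‖ :=
        mul_le_mul_of_nonneg_left ((neg_le_abs _).trans (habs _)) hp.le
      _ ≤ _ := mul_le_mul_of_nonneg_right hle (norm_nonneg _)

lemma r_eq_rad {n : ℕ} {κ : ℝ} (hκ : 0 < κ) {x : E n} (hx : x ∈ space n) :
    r n κ x = rad κ ‖x‖ := by
  have hlb : ∀ L ∈ {L : ℝ | ∃ γ : ℝ → E n, ContDiffOn ℝ 1 γ (Icc 0 1) ∧
      MapsTo γ (Icc 0 1) (space n) ∧ γ 0 = x ∧ γ 1 = 0 ∧ L = curveLength (metric n κ) γ},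
      rad κ ‖x‖ ≤ L := by
    rintro L ⟨γ, hγ, hm, h0, h1, rfl⟩
    exact rad_le_curveLength hκ hγ hm h0 h1
  have hmem : rad κ ‖x‖ ∈ {L : ℝ | ∃ γ : ℝ → E n, ContDiffOn ℝ 1 γ (Icc 0 1) ∧
      MapsTo γ (Icc 0 1) (space n) ∧ γ 0 = x ∧ γ 1 = 0 ∧ L = curveLength (metric n κ) γ} := by
    refine ⟨fun t => (1 - t) • x, by fun_prop, fun t ht => ?_, by simp, by simp,
      (curveLength_segment hκ hx).symm⟩
    rw [space, mem_ball_zero_iff, norm_smul, Real.norm_of_nonneg (by linarith [ht.2])]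
    nlinarith [norm_nonneg x, ht.1, (norm_mem_Ioo hx).2]
  exact le_antisymm (csInf_le ⟨_, hlb⟩ hmem) (le_csInf ⟨_, hmem⟩ hlb)

lemma geodBall_eq {n : ℕ} {κ R : ℝ} (hκ : 0 < κ) :
    geodBall n κ R = Metric.ball 0 (Real.tanh (√κ * R / 2)) := by
  have hk := Real.sqrt_pos.2 hκ
  have hT : Real.tanh (√κ * R / 2) ∈ Ioo (-1 : ℝ) 1 :=
    ⟨Real.neg_one_lt_tanh _, Real.tanh_lt_one _⟩
  have key : ∀ x ∈ space n, r n κ x < R ↔ ‖x‖ < Real.tanh (√κ * R / 2) := fun x hx => by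
    rw [r_eq_rad hκ hx, rad, ← Real.artanh_lt_artanh_iff (norm_mem_Ioo hx) hT, Real.artanh_tanh,
      div_mul_eq_mul_div, div_lt_iff₀ hk, lt_div_iff₀ two_pos, mul_comm 2, mul_comm R]
  ext x
  rw [mem_ball_zero_iff]
  constructor
  · rintro ⟨hx, h⟩
    exact (key x hx).1 h
  · intro h
    have hx : x ∈ space n := by
      rw [space, mem_ball_zero_iff]
      exact h.trans hT.2
    exact ⟨hx, (key x hx).2 h⟩

/-! ### Volume and gradient in conformal form -/

lemma gram_metric {n : ℕ} {κ : ℝ} (hκ : 0 < κ) (x : E n) :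
    gram (metric n κ) x = (conf κ ‖x‖ ^ 2) • (1 : Matrix (Fin n) (Fin n) ℝ) := by
  ext i j
  simp [gram, metric, conf_sq hκ, Matrix.one_apply, EuclideanSpace.inner_single_left]

/-- The absolute value makes the densities agree everywhere, also outside the ball, where `conf` is
not positive. -/
lemma vol_eq {n : ℕ} {κ : ℝ} (hκ : 0 < κ) :
    vol n κ = (volume.restrict (space n)).withDensity
      fun x => ENNReal.ofReal (|conf κ ‖x‖| ^ n) := by
  unfold vol riemVolume
  congr 1
  ext x
  rw [gram_metric hκ, Matrix.det_smul, Matrix.det_one, mul_one, Fintype.card_fin, ← pow_mul,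
    mul_comm, pow_mul, Real.sqrt_sq_eq_abs, abs_pow]

/-- The Euclidean gradient. -/
def eucGrad {n : ℕ} (u : E n → ℝ) (x : E n) : E n :=
  WithLp.toLp 2 fun j => fderiv ℝ u x (EuclideanSpace.single j 1)

lemma inner_eucGrad {n : ℕ} (u : E n → ℝ) (x v : E n) :
    inner ℝ (eucGrad u x) v = fderiv ℝ u x v := by
  conv_rhs => rw [← (EuclideanSpace.basisFun (Fin n) ℝ).sum_repr v]
  simp [eucGrad, PiLp.inner_apply, map_sum]

lemma gradSq_eq {n : ℕ} {κ : ℝ} (hκ : 0 < κ) (u : E n → ℝ) {x : E n} (hx : x ∈ space n) :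
    gradSq n κ u x = ‖eucGrad u x‖ ^ 2 / conf κ ‖x‖ ^ 2 := by
  have hc := conf_pos hκ (norm_mem_Ioo hx)
  have hg : riemGradient (metric n κ) u x = (conf κ ‖x‖ ^ 2)⁻¹ • eucGrad u x := by
    have hinv : (gram (metric n κ) x)⁻¹
        = (conf κ ‖x‖ ^ 2)⁻¹ • (1 : Matrix (Fin n) (Fin n) ℝ) := by
      rw [gram_metric hκ]
      refine Matrix.inv_eq_right_inv ?_
      rw [smul_mul_smul_comm, mul_inv_cancel₀ (by positivity), one_smul, mul_one]
    rw [riemGradient, hinv, Matrix.smul_mulVec, Matrix.one_mulVec]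
    rfl
  rw [gradSq, hg, metric, ← conf_sq hκ, real_inner_smul_left, real_inner_smul_right,
    real_inner_self_eq_norm_sq]
  field_simp

/-! ### Integration in polar coordinates -/

/-- A function whose integrals along all rays from the origin, weighted with `t ^ (dim - 1)`,
are nonnegative has a nonnegative integral. -/
lemma integral_nonneg_of_radial {V : Type*} [NormedAddCommGroup V] [NormedSpace ℝ V]
    [Nontrivial V] [FiniteDimensional ℝ V] [MeasurableSpace V] [BorelSpace V] (μ : Measure V)
    [μ.IsAddHaarMeasure] {F : V → ℝ} (hF : Integrable F μ)
    (h : ∀ ω : V, ‖ω‖ = 1 →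
      0 ≤ ∫ t in Ioi (0 : ℝ), t ^ (Module.finrank ℝ V - 1) * F (t • ω)) :
    0 ≤ ∫ x, F x ∂μ := by
  have hms : MeasurableSet ({0}ᶜ : Set V) := (measurableSet_singleton _).compl
  have mp := μ.measurePreserving_homeomorphUnitSphereProd
  have hemb := (homeomorphUnitSphereProd V).measurableEmbedding
  set G : Metric.sphere (0 : V) 1 × Ioi (0 : ℝ) → ℝ := fun p => F (p.2.1 • p.1.1) with hG
  have hcomp : G ∘ homeomorphUnitSphereProd V = F ∘ ((↑) : ({0}ᶜ : Set V) → V) := by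
    ext x
    have hx : ‖(x : V)‖ ≠ 0 := norm_ne_zero_iff.2 x.2
    simp [hG, smul_smul, hx]
  have hGi : Integrable G (μ.toSphere.prod (.volumeIoiPow (Module.finrank ℝ V - 1))) := by
    rw [← mp.integrable_comp_emb hemb, hcomp, ← integrableOn_iff_comap_subtypeVal hms]
    exact hF.integrableOn
  have e1 : ∫ x, F x ∂μ = ∫ p, G p ∂(μ.toSphere.prod (.volumeIoiPow (Module.finrank ℝ V - 1))) := by
    rw [← mp.integral_comp hemb]
    change _ = ∫ x, (G ∘ homeomorphUnitSphereProd V) x ∂_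
    rw [hcomp]
    change _ = ∫ x : ({0}ᶜ : Set V), F x ∂_
    rw [integral_subtype_comap hms, restrict_compl_singleton]
  rw [e1, integral_prod _ hGi]
  refine integral_nonneg fun ω => ?_
  have hω : ‖(ω : V)‖ = 1 := by simp
  refine (h ω hω).trans_eq ?_
  rw [Measure.volumeIoiPow, integral_withDensity_eq_integral_toReal_smul (by fun_prop) (by simp),
    ← integral_subtype_comap measurableSet_Ioi
      fun t : ℝ => t ^ (Module.finrank ℝ V - 1) * F (t • (ω : V))]
  refine integral_congr_ae (.of_forall fun t => ?_)
  have ht : 0 ≤ (t : ℝ) := t.2.le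
  simp [hG, ENNReal.toReal_ofReal (pow_nonneg ht _)]

/-! ### The radial weight -/

/-- The weight as a function of the Euclidean distance to the origin. -/
def radWeight (n : ℕ) (κ t : ℝ) : ℝ :=
  ((n : ℝ) - 1) ^ 2 * κ / 4 + 1 / (4 * rad κ t ^ 2)
    + ((n : ℝ) - 1) * ((n : ℝ) - 3) * κ / (4 * Real.sinh (√κ * rad κ t) ^ 2)

lemma sqrt_mul_rad {κ : ℝ} (hκ : 0 < κ) (t : ℝ) : √κ * rad κ t = 2 * Real.artanh t := by
  have := (Real.sqrt_pos.2 hκ).ne'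
  rw [rad]
  field_simp

lemma sinh_sqrt_mul_rad {κ t : ℝ} (hκ : 0 < κ) (ht : t ∈ Ioo (-1 : ℝ) 1) :
    Real.sinh (√κ * rad κ t) = 2 * t / (1 - t ^ 2) := by
  have h := one_sub_sq_pos ht
  rw [sqrt_mul_rad hκ, Real.sinh_two_mul, Real.sinh_artanh ht, Real.cosh_artanh ht,
    mul_one_div, mul_div_assoc', div_div, Real.mul_self_sqrt h.le]

lemma rad_pos {κ t : ℝ} (hκ : 0 < κ) (ht : t ∈ Ioo (0 : ℝ) 1) : 0 < rad κ t :=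
  mul_pos (div_pos two_pos (Real.sqrt_pos.2 hκ)) (Real.artanh_pos ht)

lemma le_artanh {t : ℝ} (ht : t ∈ Ico (0 : ℝ) 1) : t ≤ Real.artanh t := by
  have hsub : ∀ s ∈ Icc (0 : ℝ) t, s ∈ Ioo (-1 : ℝ) 1 := fun s hs =>
    ⟨by linarith [hs.1], hs.2.trans_lt ht.2⟩
  have hm : MonotoneOn (fun s => Real.artanh s - s) (Icc 0 t) := by
    refine monotoneOn_of_deriv_nonneg (convex_Icc 0 t)
      (fun s hs => ((hasDerivAt_artanh (hsub s hs)).sub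
        (hasDerivAt_id s)).continuousAt.continuousWithinAt)
      (fun s hs => ((hasDerivAt_artanh (hsub s (interior_subset hs))).sub
        (hasDerivAt_id s)).differentiableAt.differentiableWithinAt) fun s hs => ?_
    have hs' := hsub s (interior_subset hs)
    have hd : HasDerivAt (fun s => Real.artanh s - s) (1 / (1 - s ^ 2) - 1) s :=
      (hasDerivAt_artanh hs').sub (hasDerivAt_id s)
    rw [hd.deriv, sub_nonneg]
    exact one_le_one_div (one_sub_sq_pos hs') (by nlinarith [sq_nonneg s])
  have := hm (left_mem_Icc.2 ht.1) (right_mem_Icc.2 ht.1) ht.1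
  simpa using this

/-- Only n = 2 makes the sinh term negative. Since (n-1)(n-3) = (n-2)² - 1 ≥ -1, that term is at
least -κ/(4 sinh²), which 1/(4r²) absorbs because sinh s ≥ s. -/
lemma radWeight_nonneg {n : ℕ} (hn : 2 ≤ n) {κ t : ℝ} (hκ : 0 < κ) (ht : t ∈ Ioo (0 : ℝ) 1) :
    0 ≤ radWeight n κ t := by
  have hr := rad_pos hκ ht
  have hx : 0 < √κ * rad κ t := mul_pos (Real.sqrt_pos.2 hκ) hr
  have hs : √κ * rad κ t ≤ Real.sinh (√κ * rad κ t) := Real.self_le_sinh_iff.2 hx.le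
  set S := Real.sinh (√κ * rad κ t)
  have h1 : κ / (4 * S ^ 2) ≤ 1 / (4 * rad κ t ^ 2) := by
    rw [div_le_div_iff₀ (by positivity) (by positivity)]
    have : κ * rad κ t ^ 2 ≤ S ^ 2 := by
      calc κ * rad κ t ^ 2 = (√κ * rad κ t) ^ 2 := by rw [mul_pow, Real.sq_sqrt hκ.le]
        _ ≤ S ^ 2 := pow_le_pow_left₀ hx.le hs 2
    linarith
  have hn' : (2 : ℝ) ≤ n := by exact_mod_cast hn
  have h2 : -(κ / (4 * S ^ 2)) ≤ ((n : ℝ) - 1) * ((n : ℝ) - 3) * κ / (4 * S ^ 2) := by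
    rw [mul_div_assoc]
    have : 0 ≤ κ / (4 * S ^ 2) := by positivity
    nlinarith [mul_nonneg (sq_nonneg ((n : ℝ) - 2)) this]
  have h3 : 0 ≤ ((n : ℝ) - 1) ^ 2 * κ / 4 := by positivity
  rw [radWeight]
  linarith

lemma continuousOn_rad {κ : ℝ} : ContinuousOn (rad κ) (Ioo (-1) 1) := fun _ ht =>
  (hasDerivAt_rad ht).continuousAt.continuousWithinAt

lemma continuousOn_radWeight (n : ℕ) {κ : ℝ} (hκ : 0 < κ) :
    ContinuousOn (radWeight n κ) (Ioo 0 1) := by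
  have hr : ContinuousOn (rad κ) (Ioo 0 1) :=
    continuousOn_rad.mono (Ioo_subset_Ioo_left (by norm_num))
  unfold radWeight
  refine (continuousOn_const.add (continuousOn_const.div (continuousOn_const.mul (hr.pow 2))
    fun t ht => ?_)).add (continuousOn_const.div (continuousOn_const.mul
      ((Real.continuous_sinh.comp_continuousOn (continuousOn_const.mul hr)).pow 2)) fun t ht => ?_)
  · exact (mul_pos four_pos (pow_pos (rad_pos hκ ht) 2)).ne'
  · have := Real.sinh_pos_iff.2 (mul_pos (Real.sqrt_pos.2 hκ) (rad_pos hκ ht))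
    exact (mul_pos four_pos (pow_pos this 2)).ne'

/-! ### The weighted inequality on a ray -/

/-- The coefficient `(n - 1) / 2 * √κ * coth (√κ r) - 1 / (2 r)` of the supersolution
`r ^ (1 / 2) * sinh (√κ r) ^ (-(n - 1) / 2)`. -/
def drift (n : ℕ) (κ t : ℝ) : ℝ :=
  ((n : ℝ) - 1) * √κ / 4 * (t⁻¹ + t) - (2 * rad κ t)⁻¹

/-- From t ≤ artanh t one gets 1/(2r) ≤ √κ/(4t), and n - 1 ≥ 1 does the rest. -/
lemma drift_nonneg {n : ℕ} (hn : 2 ≤ n) {κ t : ℝ} (hκ : 0 < κ) (ht : t ∈ Ioo (0 : ℝ) 1) :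
    0 ≤ drift n κ t := by
  have hn' : (2 : ℝ) ≤ n := by exact_mod_cast hn
  have hs := Real.sqrt_pos.2 hκ
  have h0 := ht.1
  have ha := le_artanh ⟨ht.1.le, ht.2⟩
  have h1 : (2 * rad κ t)⁻¹ ≤ √κ / 4 * t⁻¹ := by
    have : (2 * rad κ t)⁻¹ = √κ / 4 * (Real.artanh t)⁻¹ := by
      rw [rad]
      field_simp
      norm_num
    rw [this]
    gcongr
  have h2 : √κ / 4 * t⁻¹ ≤ ((n : ℝ) - 1) * √κ / 4 * (t⁻¹ + t) := by
    rw [mul_div_assoc, mul_assoc]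
    have h3 : √κ / 4 * t⁻¹ ≤ √κ / 4 * (t⁻¹ + t) := by
      gcongr
      linarith
    have h4 : 0 ≤ √κ / 4 * (t⁻¹ + t) := by positivity
    nlinarith
  rw [drift]
  linarith

lemma hasDerivAt_drift (n : ℕ) {κ t : ℝ} (hκ : 0 < κ) (ht : t ∈ Ioo (0 : ℝ) 1) :
    HasDerivAt (drift n κ) (((n : ℝ) - 1) * √κ / 4 * (-(t ^ 2)⁻¹ + 1)
      + conf κ t / (2 * rad κ t ^ 2)) t := by
  have hr := rad_pos hκ ht
  have h1 := ((hasDerivAt_inv ht.1.ne').add (hasDerivAt_id t)).const_mul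
    (((n : ℝ) - 1) * √κ / 4)
  have h2 := ((hasDerivAt_rad (κ := κ) ⟨by linarith [ht.1], ht.2⟩).const_mul 2).inv
    (by positivity)
  refine (h1.sub h2).congr_deriv ?_
  field_simp
  ring

/-- Here h t = sinh(√κ r)/√κ, so with k = n - 2 the power is the density J of geodesic spheres. -/
lemma hasDerivAt_conf_mul_pow (k : ℕ) {κ t : ℝ} (hκ : 0 < κ) (ht : t ∈ Ioo (0 : ℝ) 1) :
    HasDerivAt (fun t => (conf κ t * t) ^ (k + 1))
      ((k + 1) * (1 + t ^ 2) / (t * (1 - t ^ 2)) * (conf κ t * t) ^ (k + 1)) t := by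
  have hp : 0 < 1 - t ^ 2 := one_sub_sq_pos ⟨by linarith [ht.1], ht.2⟩
  have hs := Real.sqrt_pos.2 hκ
  have h0 := ht.1
  have h1 : HasDerivAt (conf κ) (conf κ t * (2 * t / (1 - t ^ 2))) t := by
    have h := (hasDerivAt_const t (2 : ℝ)).div
      ((((hasDerivAt_id t).pow 2).const_sub 1).const_mul √κ) (mul_pos hs hp).ne'
    refine h.congr_deriv ?_
    simp only [conf, id, Pi.pow_apply]
    field_simp
    ring
  refine ((h1.mul (hasDerivAt_id t)).pow (k + 1)).congr_deriv ?_
  simp only [id, Pi.mul_apply, Nat.add_sub_cancel, pow_succ (conf κ t * t) k]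
  push_cast
  field_simp
  ring

/-- The Riccati equation a' + a (log J)' = h (a² + w) of the supersolution, with derivatives in t.
-/
lemma drift_riccati (k : ℕ) {κ t : ℝ} (hκ : 0 < κ) (ht : t ∈ Ioo (0 : ℝ) 1) :
    (((k + 2 : ℕ) : ℝ) - 1) * √κ / 4 * (-(t ^ 2)⁻¹ + 1) + conf κ t / (2 * rad κ t ^ 2)
      + drift (k + 2) κ t * ((k + 1) * (1 + t ^ 2) / (t * (1 - t ^ 2)))
      = conf κ t * (drift (k + 2) κ t ^ 2 + radWeight (k + 2) κ t) := by
  have ht' : t ∈ Ioo (-1 : ℝ) 1 := ⟨by linarith [ht.1], ht.2⟩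
  have hp : 0 < 1 - t ^ 2 := one_sub_sq_pos ht'
  have hs := Real.sqrt_pos.2 hκ
  have h0 := ht.1
  have hr := rad_pos hκ ht
  rw [radWeight, sinh_sqrt_mul_rad hκ ht', drift, conf]
  -- Once sinh is rewritten in t, the identity is rational in t, √κ and r, and holds for arbitrary
  -- nonzero r.
  generalize rad κ t = ρ at *
  have hk : κ = √κ ^ 2 := (Real.sq_sqrt hκ.le).symm
  generalize √κ = s at *
  subst hk
  push_cast
  field_simp
  ring

lemma integral_ray_nonneg (k : ℕ) {κ ρ b : ℝ} (hκ : 0 < κ) (hρ : 0 < ρ) (hρb : ρ ≤ b)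
    (hb : b < 1) {g g' N : ℝ → ℝ} (hg : ∀ t, HasDerivAt g (g' t) t) (hN : ∀ t, g' t ^ 2 ≤ N t)
    (hNc : Continuous N) (hgb : g b = 0) :
    0 ≤ ∫ t in ρ..b, t ^ (k + 1) * (conf κ t ^ (k + 2) *
      (N t / conf κ t ^ 2 - radWeight (k + 2) κ t * g t ^ 2)) := by
  have hsub : Icc ρ b ⊆ Ioo 0 1 := Icc_subset_Ioo hρ hb
  have hsub' : Ioo (0 : ℝ) 1 ⊆ Ioo (-1) 1 := Ioo_subset_Ioo_left (by norm_num)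
  have hgc : Continuous g := continuous_iff_continuousAt.2 fun t => (hg t).continuousAt
  have hV : ∀ t ∈ Ioo (0 : ℝ) 1, HasDerivAt
      (fun t => -(drift (k + 2) κ t * (conf κ t * t) ^ (k + 1) * g t ^ 2)) _ t := fun t ht =>
    (((hasDerivAt_drift (k + 2) hκ ht).mul (hasDerivAt_conf_mul_pow k hκ ht)).mul
      ((hg t).pow 2)).neg
  -- The integrand is bounded below by the derivative of -a J g². This form of the fundamental
  -- theorem needs no integrability of that derivative, so `g'` need not be continuous.
  have key := intervalIntegral.sub_le_integral_of_hasDeriv_right_of_le hρb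
    (φ := fun t => t ^ (k + 1) * (conf κ t ^ (k + 2) *
      (N t / conf κ t ^ 2 - radWeight (k + 2) κ t * g t ^ 2)))
    (fun t ht => (hV t (hsub ht)).continuousAt.continuousWithinAt)
    (fun t ht => (hV t (hsub (Ioo_subset_Icc_self ht))).hasDerivWithinAt) ?_ ?_
  · refine le_trans ?_ key
    have h1 := drift_nonneg (n := k + 2) (by omega) hκ (hsub (left_mem_Icc.2 hρb))
    have h2 := conf_pos hκ (hsub' (hsub (left_mem_Icc.2 hρb)))
    rw [hgb]
    have : 0 ≤ drift (k + 2) κ ρ * (conf κ ρ * ρ) ^ (k + 1) * g ρ ^ 2 := by positivity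
    simpa using this
  · refine ContinuousOn.integrableOn_Icc ?_
    have hc := ((continuousOn_conf hκ).mono hsub').mono hsub
    have hw := (continuousOn_radWeight (k + 2) hκ).mono hsub
    refine (continuousOn_id.pow _).mul ((hc.pow _).mul ((hNc.continuousOn.div (hc.pow 2)
      fun t ht => ?_).sub (hw.mul (hgc.continuousOn.pow 2))))
    exact pow_ne_zero _ (conf_pos hκ (hsub' (hsub ht))).ne'
  · intro t ht
    have ht' := hsub (Ioo_subset_Icc_self ht)
    have hR := drift_riccati k hκ ht'
    have hh := conf_pos hκ (hsub' ht')
    have h0 := ht'.1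
    simp only [Pi.mul_apply, Pi.pow_apply]
    set a := drift (k + 2) κ t
    set B := ((k : ℝ) + 1) * (1 + t ^ 2) / (t * (1 - t ^ 2))
    set a' := (((k + 2 : ℕ) : ℝ) - 1) * √κ / 4 * (-(t ^ 2)⁻¹ + 1) + conf κ t / (2 * rad κ t ^ 2)
    set h := conf κ t
    set w := radWeight (k + 2) κ t
    have hJ : 0 ≤ (h * t) ^ (k + 1) := by positivity
    have e1 : t ^ (k + 1) * (h ^ (k + 2) * (N t / h ^ 2 - w * g t ^ 2))
        = (h * t) ^ (k + 1) * (N t / h - h * w * g t ^ 2) := by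
      rw [mul_pow, pow_succ h (k + 1)]
      field_simp
    -- The difference of the two integrands divided by J; the Riccati identity completes the square.
    have e2 : 0 ≤ (N t / h - h * w * g t ^ 2) + (a' * g t ^ 2 + a * B * g t ^ 2
        + 2 * a * g t * g' t) := by
      have e3 : (N t / h - h * w * g t ^ 2) + (a' * g t ^ 2 + a * B * g t ^ 2
          + 2 * a * g t * g' t) = (N t - g' t ^ 2) / h + h * (g' t / h + a * g t) ^ 2 := by
        have : a' * g t ^ 2 + a * B * g t ^ 2 = h * (a ^ 2 + w) * g t ^ 2 := by
          rw [← hR]; ring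
        rw [this]
        field_simp
        ring
      rw [e3]
      have := sub_nonneg.2 (hN t)
      positivity
    rw [e1, ← sub_nonneg]
    refine (mul_nonneg hJ e2).trans_eq ?_
    push_cast
    ring

/-! ### Integrability and the exterior inequality -/

lemma tanh_pos {x : ℝ} (hx : 0 < x) : 0 < Real.tanh x := by
  rw [Real.tanh_eq_sinh_div_cosh]
  exact div_pos (Real.sinh_pos_iff.2 hx) (Real.cosh_pos x)

lemma measurable_density (n : ℕ) (κ : ℝ) :
    Measurable fun x : E n => ENNReal.ofReal (|conf κ ‖x‖| ^ n) := by
  unfold conf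
  fun_prop

lemma integrableOn_vol_iff {n : ℕ} {κ : ℝ} (hκ : 0 < κ) {S : Set (E n)} (hS : MeasurableSet S)
    (hSs : S ⊆ space n) (f : E n → ℝ) :
    IntegrableOn f S (vol n κ) ↔ IntegrableOn (fun x => |conf κ ‖x‖| ^ n * f x) S volume := by
  rw [IntegrableOn, vol_eq hκ, restrict_withDensity hS, Measure.restrict_restrict hS,
    inter_eq_self_of_subset_left hSs,
    integrable_withDensity_iff_integrable_smul' (measurable_density n κ) (by simp)]
  simp [IntegrableOn]

lemma setIntegral_vol {n : ℕ} {κ : ℝ} (hκ : 0 < κ) {S : Set (E n)} (hS : MeasurableSet S)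
    (hSs : S ⊆ space n) (f : E n → ℝ) :
    ∫ x in S, f x ∂(vol n κ) = ∫ x in S, |conf κ ‖x‖| ^ n * f x := by
  rw [vol_eq hκ, setIntegral_withDensity_eq_setIntegral_toReal_smul (measurable_density n κ)
    (by simp) _ hS, Measure.restrict_restrict hS, inter_eq_self_of_subset_left hSs]
  simp

lemma integrableOn_annulus {n : ℕ} {f : E n → ℝ} {ρ b : ℝ}
    (hc : ContinuousOn f (Metric.closedBall 0 b \ Metric.ball 0 ρ))
    (h0 : ∀ x, b ≤ ‖x‖ → f x = 0) : IntegrableOn f (space n \ Metric.ball 0 ρ) := by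
  have hK := (isCompact_closedBall (0 : E n) b).diff (Metric.isOpen_ball (x := 0) (ε := ρ))
  refine (hc.integrableOn_compact hK).of_forall_sdiff_eq_zero
    (measurableSet_ball.diff measurableSet_ball) fun x hx => h0 x ?_
  by_contra! h
  exact hx.2 ⟨by simpa using h.le, hx.1.2⟩

lemma IsTestFunction.exists_support_bound {n : ℕ} {u : E n → ℝ} (hu : IsTestFunction n u) :
    ∃ b ∈ Ioo (0 : ℝ) 1, ∀ x, b ≤ ‖x‖ → u x = 0 ∧ eucGrad u x = 0 := by
  obtain ⟨b, hb, hub⟩ := exists_pos_lt_subset_ball one_pos (isClosed_tsupport u) hu.2.2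
  refine ⟨b, hb, fun x hx => ?_⟩
  have hxu : x ∉ tsupport u := fun h => by
    have := hub h
    rw [mem_ball_zero_iff] at this
    linarith
  refine ⟨image_eq_zero_of_notMem_tsupport hxu, ?_⟩
  ext j
  simp [eucGrad, fderiv_of_notMem_tsupport ℝ hxu]

lemma continuous_eucGrad {n : ℕ} {u : E n → ℝ} (hu : IsTestFunction n u) :
    Continuous (eucGrad u) := by
  have h : Continuous (fderiv ℝ u) := hu.1.continuous_fderiv (by simp)
  exact (PiLp.continuous_toLp 2 _).comp (continuous_pi fun j => h.clm_apply continuous_const)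

lemma gradSq_nonneg {n : ℕ} {κ : ℝ} (hκ : 0 < κ) (u : E n → ℝ) {x : E n} (hx : x ∈ space n) :
    0 ≤ gradSq n κ u x := by
  rw [gradSq_eq hκ u hx]
  positivity

lemma weight_eq {n : ℕ} {κ : ℝ} (hκ : 0 < κ) {x : E n} (hx : x ∈ space n) :
    weight n κ x = radWeight n κ ‖x‖ := by
  rw [weight, radWeight, r_eq_rad hκ hx]

lemma integrableOn_gradSq {n : ℕ} {κ : ℝ} (hκ : 0 < κ) {u : E n → ℝ} (hu : IsTestFunction n u) :
    IntegrableOn (gradSq n κ u) (space n) (vol n κ) := by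
  obtain ⟨b, hb, hub⟩ := hu.exists_support_bound
  rw [integrableOn_vol_iff hκ (S := space n) measurableSet_ball subset_rfl]
  have hcb : MapsTo (fun x : E n => ‖x‖) (Metric.closedBall 0 b \ Metric.ball 0 0) (Ioo (-1) 1) :=
    fun x hx => ⟨by linarith [norm_nonneg x], (mem_closedBall_zero_iff.1 hx.1).trans_lt hb.2⟩
  have hc := (continuousOn_conf hκ).comp continuous_norm.continuousOn hcb
  -- The ball of radius 0 is empty, so the annulus lemma covers the whole space.
  have h : IntegrableOn (fun x => |conf κ ‖x‖| ^ n * (‖eucGrad u x‖ ^ 2 / conf κ ‖x‖ ^ 2))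
      (space n \ Metric.ball 0 0) := by
    refine integrableOn_annulus ((hc.abs.pow n).mul
      (((continuous_eucGrad hu).norm.pow 2).continuousOn.div (hc.pow 2)
        fun x hx => pow_ne_zero _ (conf_pos hκ (hcb hx)).ne')) fun x hx => ?_
    simp [(hub x hx).2]
  rw [Metric.ball_zero, sdiff_empty] at h
  refine h.congr_fun (fun x hx => ?_) measurableSet_ball
  simp only [gradSq_eq hκ u hx]

lemma integrableOn_weight_annulus {n : ℕ} {κ : ℝ} (hκ : 0 < κ) {u : E n → ℝ}
    (hu : IsTestFunction n u) {ρ : ℝ} (hρ : 0 < ρ) :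
    IntegrableOn (fun x => weight n κ x * u x ^ 2) (space n \ Metric.ball 0 ρ) (vol n κ) := by
  obtain ⟨b, hb, hub⟩ := hu.exists_support_bound
  have hS : MeasurableSet (space n \ Metric.ball 0 ρ) := measurableSet_ball.diff measurableSet_ball
  rw [integrableOn_vol_iff hκ hS sdiff_subset]
  have hcb : MapsTo (fun x : E n => ‖x‖) (Metric.closedBall 0 b \ Metric.ball 0 ρ) (Ioo 0 1) :=
    fun x hx => ⟨hρ.trans_le (by simpa using hx.2), (mem_closedBall_zero_iff.1 hx.1).trans_lt hb.2⟩
  have hsub' : Ioo (0 : ℝ) 1 ⊆ Ioo (-1) 1 := Ioo_subset_Ioo_left (by norm_num)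
  have hc := ((continuousOn_conf hκ).mono hsub').comp continuous_norm.continuousOn hcb
  have hw := (continuousOn_radWeight n hκ).comp continuous_norm.continuousOn hcb
  have h : IntegrableOn (fun x => |conf κ ‖x‖| ^ n * (radWeight n κ ‖x‖ * u x ^ 2))
      (space n \ Metric.ball 0 ρ) := by
    refine integrableOn_annulus ((hc.abs.pow n).mul (hw.mul (hu.1.continuous.pow 2).continuousOn))
      fun x hx => ?_
    simp [(hub x hx).1]
  refine h.congr_fun (fun x hx => ?_) hS
  simp only [weight_eq hκ hx.1]

lemma setIntegral_annulus_le {n : ℕ} (hn : 2 ≤ n) {κ : ℝ} (hκ : 0 < κ) {u : E n → ℝ}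
    (hu : IsTestFunction n u) {ρ : ℝ} (hρ : 0 < ρ) (hρ1 : ρ < 1) :
    ∫ x in space n \ Metric.ball 0 ρ, weight n κ x * u x ^ 2 ∂(vol n κ)
      ≤ ∫ x in space n \ Metric.ball 0 ρ, gradSq n κ u x ∂(vol n κ) := by
  obtain ⟨k, rfl⟩ := Nat.exists_eq_add_of_le' hn
  obtain ⟨b₀, hb₀, hub⟩ := hu.exists_support_bound
  set S : Set (E (k + 2)) := space (k + 2) \ Metric.ball 0 ρ
  have hS : MeasurableSet S := measurableSet_ball.diff measurableSet_ball
  have hi1 := integrableOn_weight_annulus hκ hu hρ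
  have hi2 := (integrableOn_gradSq hκ hu).mono_set (sdiff_subset (t := Metric.ball 0 ρ))
  rw [← sub_nonneg, ← integral_sub hi2 hi1, setIntegral_vol hκ hS sdiff_subset,
    ← integral_indicator hS]
  have hi := (integrableOn_vol_iff hκ hS sdiff_subset _).1 (hi2.sub hi1)
  refine integral_nonneg_of_radial _ (hi.integrable_indicator hS) fun ω hω => ?_
  -- The maximum keeps ρ ≤ b even when u is supported inside the removed ball.
  set b := max ρ b₀
  have hb1 : b < 1 := max_lt hρ1 hb₀.2
  have hd : ∀ t : ℝ, HasDerivAt (fun t : ℝ => u (t • ω)) (fderiv ℝ u (t • ω) ω) t := fun t => by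
    have h1 : HasFDerivAt u (fderiv ℝ u (t • ω)) (t • ω) :=
      (hu.1.differentiable (by simp) _).hasFDerivAt
    have h2 : HasDerivAt (fun t : ℝ => t • ω) ((1 : ℝ) • ω) t := (hasDerivAt_id t).smul_const ω
    rw [one_smul] at h2
    exact h1.comp_hasDerivAt t h2
  have key := integral_ray_nonneg k hκ hρ (le_max_left ρ b₀) hb1 hd
    (N := fun t => ‖eucGrad u (t • ω)‖ ^ 2) (fun t => ?_) ?_ ?_
  · rw [intervalIntegral.integral_of_le (le_max_left ρ b₀), ← integral_Icc_eq_integral_Ioc,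
      ← integral_indicator measurableSet_Icc] at key
    rw [← integral_indicator measurableSet_Ioi]
    refine key.trans_eq (integral_congr_ae (.of_forall fun t => ?_))
    have hfr : Module.finrank ℝ (E (k + 2)) - 1 = k + 1 := by simp
    by_cases ht : t ∈ Ico ρ 1
    · have ht0 : 0 < t := hρ.trans_le ht.1
      have hnt : ‖t • ω‖ = t := by rw [norm_smul, hω, mul_one, Real.norm_of_nonneg ht0.le]
      have hts : t • ω ∈ space (k + 2) := by
        rw [space, mem_ball_zero_iff, hnt]
        exact ht.2
      have htS : t • ω ∈ S := ⟨hts, by simpa [hnt] using ht.1⟩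
      have hcp := conf_pos hκ (norm_mem_Ioo hts)
      rw [indicator_of_mem (mem_Ioi.2 ht0), indicator_of_mem htS, hfr]
      simp only [weight_eq hκ hts, gradSq_eq hκ u hts, abs_of_pos hcp]
      rw [hnt]
      by_cases htb : t ≤ b
      · rw [indicator_of_mem (show t ∈ Icc ρ b from ⟨ht.1, htb⟩)]
      · rw [indicator_of_notMem fun h => htb h.2]
        have := hub (t • ω) (by rw [hnt]; exact (le_max_right _ _).trans (not_le.1 htb).le)
        simp [this.1, this.2]
    · rw [indicator_of_notMem fun h => ht ⟨h.1, h.2.trans_lt hb1⟩]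
      by_cases ht0 : t ∈ Ioi (0 : ℝ)
      · have hnt : ‖t • ω‖ = t := by
          rw [norm_smul, hω, mul_one, Real.norm_of_nonneg (le_of_lt ht0)]
        have htS : t • ω ∉ S := fun h => ht ⟨by simpa [hnt] using h.2, by
          simpa [hnt] using (norm_mem_Ioo h.1).2⟩
        rw [indicator_of_mem ht0, indicator_of_notMem htS, mul_zero]
      · rw [indicator_of_notMem ht0]
  · rw [← inner_eucGrad, sq_le_sq, abs_norm]
    simpa [hω] using abs_real_inner_le_norm (eucGrad u (t • ω)) ω
  · exact ((continuous_eucGrad hu).comp (by fun_prop)).norm.pow 2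
  · refine (hub _ ?_).1
    rw [norm_smul, hω, mul_one]
    exact (le_max_right _ _).trans (le_abs_self _)

/-! ### Exhaustion of the punctured space -/

lemma measurableSet_geodBall {n : ℕ} {κ R : ℝ} (hκ : 0 < κ) : MeasurableSet (geodBall n κ R) := by
  rw [geodBall_eq hκ]
  exact measurableSet_ball

lemma aecover_compl_geodBall {n : ℕ} (hn : 2 ≤ n) {κ : ℝ} (hκ : 0 < κ) :
    AECover ((vol n κ).restrict (space n)) Filter.atTop
      fun k : ℕ => (geodBall n κ (1 / ((k : ℝ) + 1)))ᶜ where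
  measurableSet k := (measurableSet_geodBall hκ).compl
  ae_eventually_mem := by
    have : Nontrivial (E n) := by
      have : Nonempty (Fin n) := ⟨⟨0, by omega⟩⟩
      infer_instance
    have hac : (vol n κ).restrict (space n) ≪ volume :=
      Measure.restrict_le_self.absolutelyContinuous.trans <| by
        rw [vol_eq hκ]
        exact (withDensity_absolutelyContinuous _ _).trans
          Measure.restrict_le_self.absolutelyContinuous
    filter_upwards [ae_restrict_mem measurableSet_ball,
      hac.ae_le (Measure.ae_ne volume (0 : E n))] with x hx hx0
    have hr : 0 < r n κ x := by
      rw [r_eq_rad hκ hx]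
      exact rad_pos hκ ⟨norm_pos_iff.2 hx0, (norm_mem_Ioo hx).2⟩
    filter_upwards [tendsto_one_div_add_atTop_nhds_zero_nat.eventually_lt_const hr] with k hk h
    exact lt_asymm hk h.2

end Hyp

end

theorem theorem1p3 (n : ℕ) (hn : 2 ≤ n) (κ : ℝ) (hκ : 0 < κ)
    (u : Hyp.E n → ℝ) (hu : Hyp.IsTestFunction n u) :
    (∀ R : ℝ, 0 < R →
      IntegrableOn (fun x => Hyp.gradSq n κ u x)
        (Hyp.space n \ Hyp.geodBall n κ R) (Hyp.vol n κ) ∧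
      IntegrableOn (fun x => Hyp.weight n κ x * u x ^ 2)
        (Hyp.space n \ Hyp.geodBall n κ R) (Hyp.vol n κ) ∧
      ∫ x in Hyp.space n \ Hyp.geodBall n κ R, Hyp.weight n κ x * u x ^ 2 ∂(Hyp.vol n κ)
        ≤ ∫ x in Hyp.space n \ Hyp.geodBall n κ R, Hyp.gradSq n κ u x ∂(Hyp.vol n κ)) ∧
    (IntegrableOn (fun x => Hyp.gradSq n κ u x) (Hyp.space n) (Hyp.vol n κ) ∧
      IntegrableOn (fun x => Hyp.weight n κ x * u x ^ 2) (Hyp.space n) (Hyp.vol n κ) ∧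
      ∫ x in Hyp.space n, Hyp.weight n κ x * u x ^ 2 ∂(Hyp.vol n κ)
        ≤ ∫ x in Hyp.space n, Hyp.gradSq n κ u x ∂(Hyp.vol n κ)) := by
  have hD := Hyp.integrableOn_gradSq hκ hu
  have hext : ∀ R : ℝ, 0 < R →
      IntegrableOn (fun x => Hyp.weight n κ x * u x ^ 2)
        (Hyp.space n \ Hyp.geodBall n κ R) (Hyp.vol n κ) ∧
      ∫ x in Hyp.space n \ Hyp.geodBall n κ R, Hyp.weight n κ x * u x ^ 2 ∂(Hyp.vol n κ)
        ≤ ∫ x in Hyp.space n \ Hyp.geodBall n κ R, Hyp.gradSq n κ u x ∂(Hyp.vol n κ) := by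
    intro R hR
    have hρ : 0 < Real.tanh (√κ * R / 2) := by
      have := Real.sqrt_pos.2 hκ
      exact Hyp.tanh_pos (by positivity)
    rw [Hyp.geodBall_eq hκ]
    exact ⟨Hyp.integrableOn_weight_annulus hκ hu hρ,
      Hyp.setIntegral_annulus_le hn hκ hu hρ (Real.tanh_lt_one _)⟩
  refine ⟨fun R hR => ⟨hD.mono_set sdiff_subset, hext R hR⟩, hD, ?_⟩
  have hcov := Hyp.aecover_compl_geodBall hn hκ
  have hres : ∀ k : ℕ, ((Hyp.vol n κ).restrict (Hyp.space n)).restrict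
      (Hyp.geodBall n κ (1 / ((k : ℝ) + 1)))ᶜ
      = (Hyp.vol n κ).restrict (Hyp.space n \ Hyp.geodBall n κ (1 / ((k : ℝ) + 1))) := fun k => by
    rw [Measure.restrict_restrict (Hyp.measurableSet_geodBall hκ).compl, inter_comm, Set.sdiff_eq]
  have hbd : ∀ k : ℕ, ∫ x in (Hyp.geodBall n κ (1 / ((k : ℝ) + 1)))ᶜ, Hyp.weight n κ x * u x ^ 2
      ∂((Hyp.vol n κ).restrict (Hyp.space n))
      ≤ ∫ x in Hyp.space n, Hyp.gradSq n κ u x ∂(Hyp.vol n κ) := fun k => by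
    rw [hres k]
    refine (hext _ (by positivity)).2.trans (setIntegral_mono_set hD ?_ sdiff_subset.eventuallyLE)
    filter_upwards [ae_restrict_mem measurableSet_ball] with x hx
    exact Hyp.gradSq_nonneg hκ u hx
  have hW : IntegrableOn (fun x => Hyp.weight n κ x * u x ^ 2) (Hyp.space n) (Hyp.vol n κ) := by
    -- Nonnegativity turns the uniform bound on the exterior integrals into integrability up to the
    -- origin.
    refine hcov.integrable_of_integral_bounded_of_nonneg_ae
      (∫ x in Hyp.space n, Hyp.gradSq n κ u x ∂(Hyp.vol n κ)) (fun k => ?_) ?_ (.of_forall hbd)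
    · rw [IntegrableOn, hres k]
      exact (hext _ (by positivity)).1
    · filter_upwards [ae_restrict_mem measurableSet_ball, hcov.ae_eventually_mem] with x hx hk
      obtain ⟨k, hk⟩ := hk.exists
      have hx0 : x ≠ 0 := fun h => hk <| by
        rw [Hyp.geodBall_eq hκ, h, Metric.mem_ball, dist_self]
        have := Real.sqrt_pos.2 hκ
        exact Hyp.tanh_pos (by positivity)
      rw [Hyp.weight_eq hκ hx]
      exact mul_nonneg (Hyp.radWeight_nonneg hn hκ
        ⟨norm_pos_iff.2 hx0, (Hyp.norm_mem_Ioo hx).2⟩) (sq_nonneg _)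
  exact ⟨hW, le_of_tendsto (hcov.integral_tendsto_of_countably_generated hW) (.of_forall hbd)⟩
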